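/- All digraphs are simple: they have no loops, no multiple arcs and no directed circuits of length $2$. The chromatic number of a digraph is that of its underlying undirected graph, and a digraph $D$ contains a digraph $H$ if $H$ is isomorphic to a (not necessarily induced) subdigraph of $D$. For integers $k,l\ge 1$, let $P(k,1,l)$ be the oriented path with vertices $x_0,x_1,\dots,x_{k+l+1}$ (all distinct) that consists of $k$ forward arcs, followed by one backward arc, followed by $l$ forward arcs; that is, its arcs are $(x_i,x_{i+1})$ for $0\le i\le k+l$ with $i\ne k$, together with $(x_{k+1},x_k)$. Its length is $k+1+l$. **Theorem.** Let $n\ge 7$ and let $D$ be a digraph with chromatic number at least $2n-3$. Then $D$ contains every path $P(k,1,l)$ of length $k+1+l=n-1$ with $k,l\ge 1$. -/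

import Mathlib

namespace Digraph

/-- A digraph is simple if it has no loops and no circuits of length two
(multiple arcs are excluded by the type `Digraph` itself). -/
structure IsSimple {V : Type*} (D : Digraph V) : Prop where
  no_loop : ∀ v : V, ¬ D.Adj v v
  no_two_circuit : ∀ u v : V, D.Adj u v → ¬ D.Adj v u

/-- The chromatic number of a digraph: that of its underlying graph, in which two distinct
vertices are adjacent when there is an arc between them in some direction. -/
noncomputable def chromaticNumber {V : Type*} (D : Digraph V) : ℕ∞ :=
  D.toSimpleGraphInclusive.chromaticNumber

/-- `D.Contains H`: the digraph `H` is isomorphic to a (not necessarily induced) subdigraph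
of `D`, that is, some injective map of vertices sends every arc of `H` to an arc of `D`. -/
def Contains {V W : Type*} (D : Digraph V) (H : Digraph W) : Prop :=
  ∃ f : W → V, Function.Injective f ∧ ∀ u v : W, H.Adj u v → D.Adj (f u) (f v)

/-- The oriented path `P(k₁, k₂, k₃)` on the vertices `0, 1, …, k₁ + k₂ + k₃`. The edge between
`i` and `i + 1` is the backward arc from `i + 1` to `i` if `k₁ ≤ i < k₁ + k₂`, and the forward
arc from `i` to `i + 1` otherwise. -/
def threeBlockPath (k₁ k₂ k₃ : ℕ) : Digraph (Fin (k₁ + k₂ + k₃ + 1)) where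
  Adj i j :=
    ((j : ℕ) = (i : ℕ) + 1 ∧ ¬ (k₁ ≤ (i : ℕ) ∧ (i : ℕ) < k₁ + k₂)) ∨
    ((i : ℕ) = (j : ℕ) + 1 ∧ (k₁ ≤ (j : ℕ) ∧ (j : ℕ) < k₁ + k₂))

end Digraph

/-! ### Acyclic relations and ranks -/

open Relation

/-! Suppose a finite `D` has no `P(k,1,l)`. Fix a maximal acyclic set `M` of arcs, and let `d v`, `e
v` be the lengths of the longest `M`-paths ending and starting at `v`. By maximality, every arc
outside `M` closes a cycle with `M`, so along every arc both ranks change. Hence `d` colours the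
vertices with `d < k`, and `e` those of the rest with `e < l`. On the remaining set `W` all arcs lie
in `M`, and they split into two forests, each bipartite, so `4` more colours suffice. The total `k +
l + 4` is less than `2n - 3`; compactness covers infinite `D`. -/

/-- Adjoining a single pair `(x, y)` to a relation creates only those new connections that pass
through that pair. -/
theorem Relation.transGen_or_pair {V : Type*} {M : V → V → Prop} {x y a b : V}
    (h : TransGen (fun u v => M u v ∨ (u = x ∧ v = y)) a b) :
    TransGen M a b ∨ (ReflTransGen M a x ∧ ReflTransGen M y b) := by
  induction h with
  | single h =>
    rcases h with h | ⟨rfl, rfl⟩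
    · exact Or.inl (.single h)
    · exact Or.inr ⟨.refl, .refl⟩
  | tail _ h ih =>
    rcases h with h | ⟨rfl, rfl⟩
    · rcases ih with ih | ⟨ih₁, ih₂⟩
      · exact Or.inl (ih.tail h)
      · exact Or.inr ⟨ih₁, ih₂.tail h⟩
    · rcases ih with ih | ⟨ih₁, -⟩
      · exact Or.inr ⟨ih.to_reflTransGen, .refl⟩
      · exact Or.inr ⟨ih₁, .refl⟩

/-- Every relation on a finite type has a maximal acyclic subrelation. -/
theorem Relation.exists_maximal_acyclic {V : Type*} [Finite V] (R : V → V → Prop) :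
    ∃ M : V → V → Prop, (∀ x y, M x y → R x y) ∧ (∀ x, ¬ TransGen M x x) ∧
      ∀ x y, R x y → ¬ M x y → ReflTransGen M y x := by
  have h₀ : ¬ ∃ x : V, TransGen (fun _ _ : V => False) x x := by
    rintro ⟨x, hx⟩
    cases hx <;> assumption
  obtain ⟨M, -, hM⟩ := Finite.exists_le_maximal
    (p := fun M : V → V → Prop => (∀ x y, M x y → R x y) ∧ ∀ x, ¬ TransGen M x x)
    (a := fun _ _ => False) ⟨fun _ _ h => h.elim, fun x hx => h₀ ⟨x, hx⟩⟩
  refine ⟨M, hM.prop.1, hM.prop.2, fun x y hxy hn => ?_⟩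
  by_contra hyx
  refine hn (hM.le_of_ge (y := fun u v => M u v ∨ (u = x ∧ v = y)) ⟨?_, ?_⟩
    (fun u v h => Or.inl h) x y (Or.inr ⟨rfl, rfl⟩))
  · rintro u v (h | ⟨rfl, rfl⟩)
    · exact hM.prop.1 u v h
    · exact hxy
  · intro z hz
    rcases transGen_or_pair hz with h | ⟨h₁, h₂⟩
    · exact hM.prop.2 z h
    · exact hyx (h₂.trans h₁)

theorem Relation.wellFounded_of_acyclic {V : Type*} [Finite V] {M : V → V → Prop}
    (h : ∀ x, ¬ TransGen M x x) : WellFounded M := by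
  have : Std.Irrefl (TransGen M) := ⟨h⟩
  exact Subrelation.wf (fun h => TransGen.single h)
    (Finite.wellFounded_of_trans_of_irrefl (TransGen M))

/-- A well-founded relation on a finite type has a natural-valued rank in which every value below
the rank of a point is attained along a descending path. -/
theorem WellFounded.exists_nat_rank {V : Type*} [Finite V] {M : V → V → Prop}
    (h : WellFounded M) :
    ∃ d : V → ℕ, (∀ u v, M u v → d u < d v) ∧ ∀ v m, m < d v → ∃ u, M u v ∧ m ≤ d u := by
  classical
  cases nonempty_fintype V
  -- The length of the longest `M`-chain ending at `v`; non-predecessors contribute the neutral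
  -- value `0`.
  let F : (v : V) → ((u : V) → M u v → ℕ) → ℕ := fun v f =>
    Finset.univ.sup fun u => if hu : M u v then f u hu + 1 else 0
  have hF : ∀ v, h.fix F v = Finset.univ.sup fun u => if M u v then h.fix F u + 1 else 0 := by
    intro v
    rw [h.fix_eq]
    simp [F]
  refine ⟨h.fix F, fun u v huv => ?_, fun v m hm => ?_⟩
  · rw [hF v, Finset.lt_sup_iff]
    exact ⟨u, Finset.mem_univ u, by simp [huv]⟩
  · rw [hF v, Finset.lt_sup_iff] at hm
    obtain ⟨u, -, hu⟩ := hm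
    by_cases huv : M u v
    · rw [if_pos huv] at hu
      exact ⟨u, huv, by omega⟩
    · simp [huv] at hu

/-- A well-founded relation in which every element has at most one predecessor is bipartite. -/
theorem WellFounded.exists_two_coloring {V : Type*} {r : V → V → Prop} (h : WellFounded r)
    (hr : ∀ x x' y, r x y → r x' y → x = x') : ∃ c : V → Bool, ∀ x y, r x y → c x ≠ c y := by
  classical
  let F : (v : V) → ((u : V) → r u v → Bool) → Bool := fun v f =>
    if hv : ∃ u, r u v then ! f hv.choose hv.choose_spec else false
  refine ⟨h.fix F, fun x y hxy => ?_⟩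
  have hy : ∃ u, r u y := ⟨x, hxy⟩
  have hx : hy.choose = x := hr _ _ _ hy.choose_spec hxy
  have h₁ : h.fix F y = ! h.fix F hy.choose := by
    rw [h.fix_eq]
    simp [F, hy]
  rw [h₁, hx]
  simp

/-! ### Walks and ranks -/

/-- `IsWalk M p m`: the terms `p 0, …, p m` form a walk of length `m` in the relation `M`. -/
def IsWalk {V : Type*} (M : V → V → Prop) (p : ℕ → V) (m : ℕ) : Prop :=
  ∀ i < m, M (p i) (p (i + 1))

namespace IsWalk

variable {V : Type*} {M : V → V → Prop} {p : ℕ → V} {m : ℕ} {d : V → ℕ}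

theorem lt (hp : IsWalk M p m) (hd : ∀ u v, M u v → d u < d v) {i j : ℕ} (hij : i < j)
    (hj : j ≤ m) : d (p i) < d (p j) := by
  induction j, hij using Nat.le_induction with
  | base => exact hd _ _ (hp i hj)
  | succ j _ ih => exact (ih (by omega)).trans (hd _ _ (hp j hj))

theorem le (hp : IsWalk M p m) (hd : ∀ u v, M u v → d u < d v) {i j : ℕ} (hij : i ≤ j)
    (hj : j ≤ m) : d (p i) ≤ d (p j) := by
  rcases hij.eq_or_lt with rfl | h
  · exact le_rfl
  · exact (hp.lt hd h hj).le

theorem injOn (hp : IsWalk M p m) (hd : ∀ u v, M u v → d u < d v) :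
    Set.InjOn p (Set.Iic m) := by
  intro i hi j hj hij
  rcases lt_trichotomy i j with h | h | h
  · exact absurd (congrArg d hij) (hp.lt hd h hj).ne
  · exact h
  · exact absurd (congrArg d hij) (hp.lt hd h hi).ne'

theorem snoc (hp : IsWalk M p m) {y : V} (h : M (p m) y) :
    IsWalk M (fun i => if i ≤ m then p i else y) (m + 1) := by
  intro i hi
  rcases (Nat.lt_succ_iff.mp hi).eq_or_lt with rfl | h'
  · simpa using h
  · simpa [h'.le, Nat.succ_le_of_lt h'] using hp i h'

theorem cons (hp : IsWalk M p m) {x : V} (h : M x (p 0)) :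
    IsWalk M (fun i => Nat.casesOn i x p) (m + 1) := by
  intro i hi
  cases i with
  | zero => exact h
  | succ i => exact hp i (by omega)

end IsWalk

/-- Build the walk backwards: a vertex of rank at least `m + 1` has a predecessor of rank at least
`m`. -/
theorem exists_isWalk_to {V : Type*} {M : V → V → Prop} {d : V → ℕ}
    (hd : ∀ v m, m < d v → ∃ u, M u v ∧ m ≤ d u) (m : ℕ) (v : V) (hv : m ≤ d v) :
    ∃ p, IsWalk M p m ∧ p m = v := by
  induction m generalizing v with
  | zero => exact ⟨fun _ => v, fun i hi => by omega, rfl⟩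
  | succ m ih =>
    obtain ⟨u, huv, hu⟩ := hd v m hv
    obtain ⟨p, hp, rfl⟩ := ih u hu
    exact ⟨_, hp.snoc huv, by simp⟩

theorem exists_isWalk_from {V : Type*} {M : V → V → Prop} {d : V → ℕ}
    (hd : ∀ v m, m < d v → ∃ u, M v u ∧ m ≤ d u) (m : ℕ) (v : V) (hv : m ≤ d v) :
    ∃ p, IsWalk M p m ∧ p 0 = v := by
  induction m generalizing v with
  | zero => exact ⟨fun _ => v, fun i hi => by omega, rfl⟩
  | succ m ih =>
    obtain ⟨u, huv, hu⟩ := hd v m hv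
    obtain ⟨p, hp, rfl⟩ := ih u hu
    exact ⟨_, hp.cons huv, rfl⟩

/-! ### Colouring finite digraphs -/

namespace Digraph

/-- Two disjoint directed paths of lengths `k` and `l`, with an arc from the start of the second
to the end of the first, form a path `P(k, 1, l)`. -/
theorem contains_threeBlockPath_of_walks {V : Type*} {D : Digraph V} {k l : ℕ} {p q : ℕ → V}
    (hp : IsWalk D.Adj p k) (hq : IsWalk D.Adj q l) (hpi : Set.InjOn p (Set.Iic k))
    (hqi : Set.InjOn q (Set.Iic l)) (hpq : ∀ i ≤ k, ∀ j ≤ l, p i ≠ q j)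
    (h : D.Adj (q 0) (p k)) : D.Contains (threeBlockPath k 1 l) := by
  refine ⟨fun i => if (i : ℕ) ≤ k then p i else q (i - (k + 1)), ?_, ?_⟩
  · rintro ⟨i, hi⟩ ⟨j, hj⟩ hij
    simp only [Fin.mk.injEq] at hij ⊢
    split_ifs at hij with h₁ h₂ h₂
    · exact hpi h₁ h₂ hij
    · exact absurd hij (hpq _ h₁ _ (by omega))
    · exact absurd hij.symm (hpq _ h₂ _ (by omega))
    · have := hqi (Set.mem_Iic.mpr (by omega)) (Set.mem_Iic.mpr (by omega)) hij
      omega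
  · rintro ⟨i, hi⟩ ⟨j, hj⟩ hij
    simp only [threeBlockPath] at hij
    rcases hij with ⟨rfl, h₁⟩ | ⟨rfl, h₁⟩
    · dsimp only
      rcases lt_or_ge i k with h₂ | h₂
      · rw [if_pos h₂.le, if_pos (by omega)]
        exact hp i h₂
      · rw [if_neg (by omega), if_neg (by omega),
          show i + 1 - (k + 1) = i - (k + 1) + 1 by omega]
        exact hq _ (by omega)
    · obtain rfl : j = k := by omega
      simpa using h

/-- A finite digraph without a path `P(k, 1, l)` is `(k + l + 4)`-colourable. -/
theorem colorable_of_not_contains_threeBlockPath {V : Type*} [Finite V] {D : Digraph V}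
    (hD : ∀ v, ¬ D.Adj v v) {k l : ℕ} (hk : 1 ≤ k) (hl : 1 ≤ l)
    (h : ¬ D.Contains (threeBlockPath k 1 l)) :
    D.toSimpleGraphInclusive.Colorable (k + l + 4) := by
  classical
  obtain ⟨M, hMD, hM, hmax⟩ := exists_maximal_acyclic D.Adj
  have hM' : ∀ x, ¬ TransGen (flip M) x x := fun x hx => hM x (transGen_swap.mp hx)
  have wf := wellFounded_of_acyclic hM
  have wf' := wellFounded_of_acyclic hM'
  obtain ⟨d, hd, hd'⟩ := wf.exists_nat_rank
  obtain ⟨e, he, he'⟩ := wf'.exists_nat_rank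
  have walk {p : ℕ → V} {m : ℕ} (hp : IsWalk M p m) : IsWalk D.Adj p m :=
    fun i hi => hMD _ _ (hp i hi)
  have hback : ∀ x y, D.Adj x y → ¬ M x y → d y < d x ∧ e x < e y := by
    intro x y hxy hn
    have hyx : TransGen M y x := by
      rcases reflTransGen_iff_eq_or_transGen.mp (hmax x y hxy hn) with rfl | h
      · exact absurd hxy (hD _)
      · exact h
    clear hxy hn
    induction hyx with
    | single h => exact ⟨hd _ _ h, he _ _ h⟩
    | tail _ h ih => exact ⟨ih.1.trans (hd _ _ h), (he _ _ h).trans ih.2⟩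
  -- Vertices that end an `M`-walk of length `k` and start one of length `l`.
  let W : Set V := {v | k ≤ d v ∧ l ≤ e v}
  -- Otherwise `d y < d x`, so a `k`-walk into `y` lies strictly below an `l`-walk out of `x`, and
  -- the arc `x → y` joins them into the forbidden path.
  have hWM : ∀ x ∈ W, ∀ y ∈ W, D.Adj x y → M x y := by
    intro x hx y hy hxy
    by_contra hn
    have hlt := (hback x y hxy hn).1
    obtain ⟨p, hp, rfl⟩ := exists_isWalk_to hd' k y hy.1
    obtain ⟨q, hq, rfl⟩ := exists_isWalk_from he' l x hx.2
    refine h (contains_threeBlockPath_of_walks (walk hp) (walk hq) (hp.injOn hd) (hq.injOn hd)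
      (fun i hi j hj hij => ?_) hxy)
    have h₁ := hp.le hd hi le_rfl
    have h₂ := hq.le hd (Nat.zero_le j) hj
    rw [hij] at h₁
    omega
  -- Every `l`-walk from `x` passes through `y`.
  let dom : V → V → Prop := fun x y => ∀ q, IsWalk M q l → q 0 = x → ∃ j ≤ l, q j = y
  -- An `l`-walk from `x'` avoiding `y` would form the forbidden path with a `k`-walk ending in `x →
  -- y`: by rank the two could only meet at `x = x'`. So at most one arc from `W` into `y` is
  -- non-dominating.
  have hdom_of_le : ∀ x ∈ W, ∀ x', ∀ y, M x y → M x' y → x ≠ x' → d x ≤ d x' → dom x' y := by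
    intro x hx x' y hxy hxy' hne hle q hq hq₀
    by_contra! hqy
    subst hq₀
    obtain ⟨k, rfl⟩ : ∃ m, k = m + 1 := ⟨k - 1, by omega⟩
    obtain ⟨p, hp, rfl⟩ := exists_isWalk_to hd' k x (by have := hx.1; omega)
    have hp' := hp.snoc hxy
    refine h (contains_threeBlockPath_of_walks (walk hp') (walk hq) (hp'.injOn hd) (hq.injOn hd)
      (fun i hi j hj hij => ?_) (by simpa using hMD _ _ hxy'))
    split_ifs at hij with hik
    · have h₁ := hp.le hd hik le_rfl
      have h₂ := hq.le hd (Nat.zero_le j) hj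
      rw [hij] at h₁
      have hik' : i = k := by
        by_contra hne'
        have := hp.lt hd (show i < k by omega) le_rfl
        rw [hij] at this
        omega
      have hj₀ : j = 0 := by
        by_contra hne'
        have := hq.lt hd (show 0 < j by omega) hj
        omega
      subst hik' hj₀
      exact hne hij
    · exact hqy j hj hij.symm
  obtain ⟨c₁, hc₁⟩ := WellFounded.exists_two_coloring
    (r := fun x y => (x ∈ W ∧ M x y) ∧ ¬ dom x y) (Subrelation.wf (fun h => h.1.2) wf) (by
      rintro x x' y ⟨⟨hx, hxy⟩, hn⟩ ⟨⟨hx', hxy'⟩, hn'⟩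
      by_contra hne
      rcases le_total (d x) (d x') with hle | hle
      · exact hn' (hdom_of_le x hx x' y hxy hxy' hne hle)
      · exact hn (hdom_of_le x' hx' x y hxy' hxy (Ne.symm hne) hle))
  -- The `l`-walk from `x` that begins with `y'` must meet `y`, but its vertices after `y'` have
  -- rank above `d y' ≥ d y`. So at most one arc from `x` into `W` is dominating.
  have hdom_eq : ∀ x y y', y' ∈ W → M x y → M x y' → dom x y → d y ≤ d y' → y = y' := by
    intro x y y' hy' hxy hxy' hdom hle
    obtain ⟨l, rfl⟩ : ∃ m, l = m + 1 := ⟨l - 1, by omega⟩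
    obtain ⟨q, hq, rfl⟩ := exists_isWalk_from he' l y' (by have := hy'.2; omega)
    obtain ⟨j, hj, rfl⟩ := hdom _ (hq.cons hxy') rfl
    cases j with
    | zero => exact absurd (hd _ _ hxy) (lt_irrefl _)
    | succ j =>
      cases j with
      | zero => rfl
      | succ j => exact absurd (hq.lt hd (Nat.succ_pos j) (by omega)) (not_lt.mpr hle)
  obtain ⟨c₂, hc₂⟩ := WellFounded.exists_two_coloring
    (r := fun y x => (y ∈ W ∧ M x y) ∧ dom x y) (Subrelation.wf (fun h => h.1.2) wf') (by
      rintro y y' x ⟨⟨hy, hxy⟩, hn⟩ ⟨⟨hy', hxy'⟩, hn'⟩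
      rcases le_total (d y) (d y') with hle | hle
      · exact hdom_eq x y y' hy' hxy hxy' hn hle
      · exact (hdom_eq x y' y hy hxy' hxy hn' hle).symm)
  let c : V → Fin k ⊕ Fin l ⊕ (Bool × Bool) := fun v =>
    if hv : d v < k then Sum.inl ⟨d v, hv⟩
    else if hv : e v < l then Sum.inr (Sum.inl ⟨e v, hv⟩)
    else Sum.inr (Sum.inr (c₁ v, c₂ v))
  have hde : ∀ x y, D.Adj x y → d x ≠ d y ∧ e x ≠ e y := by
    intro x y hxy
    by_cases hm : M x y
    · exact ⟨(hd _ _ hm).ne, (he _ _ hm).ne'⟩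
    · exact ⟨(hback x y hxy hm).1.ne', (hback x y hxy hm).2.ne⟩
  have hc : ∀ x y, D.Adj x y → c x ≠ c y := by
    intro x y hxy hcxy
    have hxy' := hde x y hxy
    by_cases h₁ : d x < k <;> by_cases h₂ : d y < k <;> by_cases h₃ : e x < l <;>
      by_cases h₄ : e y < l <;> simp [c, h₁, h₂, h₃, h₄, hxy'.1, hxy'.2] at hcxy
    have hx : x ∈ W := ⟨not_lt.mp h₁, not_lt.mp h₃⟩
    have hy : y ∈ W := ⟨not_lt.mp h₂, not_lt.mp h₄⟩
    have hm := hWM x hx y hy hxy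
    by_cases hdom : dom x y
    · exact hc₂ y x ⟨⟨hy, hm⟩, hdom⟩ hcxy.2.symm
    · exact hc₁ x y ⟨⟨hx, hm⟩, hdom⟩ hcxy.1
  have hcol := (SimpleGraph.Coloring.mk (G := D.toSimpleGraphInclusive) c (fun {x y} hxy => by
    rcases (SimpleGraph.fromRel_adj _ _ _).mp hxy with ⟨-, hxy | hxy⟩
    · exact hc x y hxy
    · exact (hc y x hxy).symm)).colorable
  simpa [add_assoc] using hcol

end Digraph

/-! ### Compactness and conclusion -/

/-- De Bruijn–Erdős: a graph all of whose finite induced subgraphs are `m`-colourable is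
`m`-colourable. -/
theorem SimpleGraph.colorable_of_forall_finite_induce {V : Type*} {G : SimpleGraph V} {m : ℕ}
    (h : ∀ s : Set V, s.Finite → (G.induce s).Colorable m) : G.Colorable m :=
  nonempty_hom_of_forall_finite_subgraph_hom fun G' hG' =>
    (h G'.verts hG').some.comp ⟨id, fun h => G'.adj_sub h⟩

theorem theorem2p1 {V : Type*} (D : Digraph V) (hD : D.IsSimple) (n : ℕ) (hn : 7 ≤ n)
    (hχ : ((2 * n - 3 : ℕ) : ℕ∞) ≤ D.chromaticNumber)
    (k l : ℕ) (hk : 1 ≤ k) (hl : 1 ≤ l) (hlen : k + 1 + l = n - 1) :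
    D.Contains (Digraph.threeBlockPath k 1 l) := by
  by_contra h
  have hcol : D.toSimpleGraphInclusive.Colorable (k + l + 4) := by
    refine SimpleGraph.colorable_of_forall_finite_induce fun s hs => ?_
    have := hs.to_subtype
    let D' : Digraph s := ⟨fun u v => D.Adj u v⟩
    refine (Digraph.colorable_of_not_contains_threeBlockPath (D := D')
      (fun v => hD.no_loop v) hk hl ?_).mono_left ?_
    · rintro ⟨f, hf, hfD⟩
      exact h ⟨fun i => f i, Subtype.val_injective.comp hf, hfD⟩
    · rintro u v ⟨hne, huv⟩
      exact ⟨fun huv => hne (congrArg Subtype.val huv), huv⟩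
  have hle := hχ.trans hcol.chromaticNumber_le
  rw [Nat.cast_le] at hle
  -- Here `2n - 3 = 2(k + l) + 1`, which exceeds `k + l + 4` since `k + l = n - 2 ≥ 5`.
  omega
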